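/- Call $f:[0,\infty)\to\mathbb{R}$ operator monotone if for every $n\in\mathbb{N}$ and all complex Hermitian $n\times n$ matrices $A,B$ with spectra in $[0,\infty)$, $A\le B$ (that is, $B-A$ is positive semidefinite) implies $f(A)\le f(B)$, where $f(A)$ is defined by the spectral resolution of $A$. For $t\in[0,\infty)$ put $$\phi_t(\lambda)=\frac{t(1+\lambda)}{t+\lambda}\ \text{ for }\lambda\in(0,\infty),\qquad \phi_t(0)=1,\qquad \phi_t(\infty)=t.$$ A continuous function $f:[0,\infty)\to[0,\infty)$ is operator monotone if and only if there is a finite Borel measure $m$ on $[0,\infty]$ such that $$f(t)=\int_{[0,\infty]}\phi_t(\lambda)\,dm(\lambda),\qquad t\in[0,\infty).$$ Moreover, the measure $m$ is unique, and $$f(t)=a+bt+\int_{(0,\infty)}\frac{t(1+\lambda)}{t+\lambda}\,dm(\lambda),\qquad t\in[0,\infty),$$ where $a:=m(\{0\})=f(0)$ and $b:=m(\{\infty\})=\lim_{t\to\infty}f(t)/t$ (in particular this limit exists). -/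

import Mathlib

open Set Filter Topology MeasureTheory
open scoped ENNReal ComplexOrder

/-- `f` is matrix monotone of degree `n` on `J`: for complex Hermitian `n × n` matrices `A`, `B` with
spectra in `J`, if `B - A` is positive semidefinite then so is `f(B) - f(A)`.  Here `f(A)` is given
by the functional calculus `cfc`, for a Hermitian matrix the one of its spectral resolution (no
continuity of `f` is involved, because the spectrum is finite). -/
def IsMatrixMonotoneOn (n : ℕ) (J : Set ℝ) (f : ℝ → ℝ) : Prop :=
  ∀ A B : Matrix (Fin n) (Fin n) ℂ, A.IsHermitian → B.IsHermitian →
    spectrum ℝ A ⊆ J → spectrum ℝ B ⊆ J →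
      (B - A).PosSemidef → (cfc f B - cfc f A).PosSemidef

/-- `f` is operator monotone on `J`: it is matrix monotone of every degree. -/
def IsOperatorMonotoneOn (J : Set ℝ) (f : ℝ → ℝ) : Prop :=
  ∀ n : ℕ, IsMatrixMonotoneOn n J f

/-- The kernel `φ_t(x)` for `x ∈ [0, ∞]`: it is `t (1 + x) / (t + x)` for `x ∈ (0, ∞)`, with
`φ_t(0) = 1` and `φ_t(∞) = t`. -/
noncomputable def phi (t : ℝ) (x : ℝ≥0∞) : ℝ :=
  if x = 0 then 1 else if x = ∞ then t else t * (1 + x.toReal) / (t + x.toReal)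

/-- `f(t) = ∫ φ_t(x) dm(x)` over `[0, ∞]`, for all `t ∈ [0, ∞)`. -/
def IsRepresentedBy (f : ℝ → ℝ) (m : Measure ℝ≥0∞) : Prop :=
  ∀ t : ℝ, 0 ≤ t → f t = ∫ x, phi t x ∂m

/-- The integrals above are never junk values: `φ_t` is integrable for every finite measure. -/
theorem integrable_phi (m : Measure ℝ≥0∞) [IsFiniteMeasure m] (t : ℝ) (ht : 0 ≤ t) :
    Integrable (phi t) m := by
  have hm : Measurable (phi t) := by
    unfold phi
    refine Measurable.ite (measurableSet_singleton 0) measurable_const ?_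
    refine Measurable.ite (measurableSet_singleton ∞) measurable_const ?_
    fun_prop
  refine Integrable.of_bound hm.aestronglyMeasurable (1 + t) (ae_of_all _ fun x => ?_)
  unfold phi
  split_ifs with h0 hi
  · simpa using ht
  · rw [Real.norm_of_nonneg ht]; linarith
  · have hx : 0 < x.toReal := ENNReal.toReal_pos h0 hi
    rw [Real.norm_of_nonneg (by positivity), div_le_iff₀ (by positivity)]
    nlinarith [mul_nonneg ht ht]

/-! Necessity is a duality argument. Cauchy-type matrices are replaced by Vandermonde ones: for 2m
interlacing nodes with barycentric weights w (the inverses of the values at the nodes of the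
derivative of the nodal polynomial), two scaled Vandermonde matrices have equal Gram matrices, while
the diagonal matrices of their nodes are ordered on them. Monotonicity of degree m then gives
Loewner's inequality: the divided difference ∑ w f q² is nonnegative for deg q < m.

Taking one node to be 0, or sending it to ∞, leaves 2m + 1 positive nodes and two inequalities,
which together say ∑ w(t) f(t) p(-t)/t ≥ 0 for p = q² and p = X q² of degree at most 2m. Every
polynomial nonnegative on (0, ∞) is a sum of such p without excess degree. If ∑ c_t φ_t ≥ 0,
clearing denominators yields such a polynomial, and the inequality becomes ∑ c_t f(t) ≥ 0. Hence φ_t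
↦ f(t) extends to a positive functional on C([0, ∞]) (M. Riesz), that is, to a measure
(Riesz–Markov–Kakutani).

Conversely, each φ_t(x) is, as a function of t, constant, the identity, or a constant minus a
positive multiple of a resolvent, hence operator monotone, and integration preserves this. For
uniqueness, the φ_t determine the integrals of 1 and of all resolvents, and these span a dense
subspace of C([0, ∞]). -/

/-! ### Functional calculus of diagonalized matrices -/

open Matrix in
theorem Polynomial.aeval_diagonal {n : Type*} [Fintype n] [DecidableEq n] (a : n → ℝ)
    (p : Polynomial ℝ) :
    Polynomial.aeval (diagonal fun i => (a i : ℂ)) p = diagonal fun i => ((p.eval (a i) : ℝ) : ℂ) := by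
  have h := Polynomial.aeval_algHom_apply (Matrix.diagonalAlgHom (n := n) (α := ℂ) ℝ)
    (fun i => (a i : ℂ)) p
  simp only [Matrix.diagonalAlgHom_apply] at h
  rw [h]
  congr 1
  ext i
  rw [show Polynomial.aeval (fun i => (a i : ℂ)) p i
    = Polynomial.aeval (a i : ℂ) p from (Polynomial.aeval_algHom_apply (Pi.evalAlgHom ℝ _ i) _ p).symm]
  rw [show ((a i : ℝ) : ℂ) = algebraMap ℝ ℂ (a i) from rfl, Polynomial.aeval_algebraMap_apply]
  simp

namespace Matrix

variable {n : Type*} [DecidableEq n]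

theorem isHermitian_diagonal_ofReal (a : n → ℝ) : (diagonal fun i => (a i : ℂ)).IsHermitian := by
  rw [IsHermitian, diagonal_conjTranspose]
  congr 1
  ext i
  simp

variable [Fintype n]

theorem spectrum_real_diagonal (a : n → ℝ) :
    spectrum ℝ (diagonal fun i => (a i : ℂ)) = range a := by
  ext x
  rw [← spectrum.algebraMap_mem_iff ℂ]
  simp

/-- On the finite spectrum f agrees with a Lagrange interpolation polynomial, and polynomials
commute with conjugation. -/
theorem cfc_conj_diagonal (f : ℝ → ℝ) (a : n → ℝ) (U : unitary (Matrix n n ℂ)) :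
    cfc f ((U : Matrix n n ℂ) * diagonal (fun i => (a i : ℂ)) * star (U : Matrix n n ℂ)) =
      (U : Matrix n n ℂ) * diagonal (fun i => (f (a i) : ℂ)) * star (U : Matrix n n ℂ) := by
  set p : Polynomial ℝ := Lagrange.interpolate (Finset.univ.image a) id f with hp
  have hpe : ∀ i, p.eval (a i) = f (a i) := fun i =>
    Lagrange.eval_interpolate_at_node (v := id) f (injOn_id _)
      (Finset.mem_image_of_mem a (Finset.mem_univ i))
  have hsa : IsSelfAdjoint (diagonal fun i => (a i : ℂ)) := isHermitian_diagonal_ofReal a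
  have hsa' : IsSelfAdjoint
      ((U : Matrix n n ℂ) * diagonal (fun i => (a i : ℂ)) * star (U : Matrix n n ℂ)) :=
    hsa.conjugate _
  have hsp : spectrum ℝ
      ((U : Matrix n n ℂ) * diagonal (fun i => (a i : ℂ)) * star (U : Matrix n n ℂ)) = range a := by
    rw [Unitary.spectrum_star_right_conjugate, spectrum_real_diagonal]
  rw [cfc_congr (g := p.eval), cfc_polynomial p _ hsa']
  · have h := Polynomial.aeval_algHom_apply (Unitary.conjStarAlgAut ℝ (Matrix n n ℂ) U)
      (diagonal fun i => (a i : ℂ)) p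
    rw [Unitary.conjStarAlgAut_apply, Unitary.conjStarAlgAut_apply] at h
    rw [h, Polynomial.aeval_diagonal]
    simp only [hpe]
  · rw [hsp]
    rintro _ ⟨i, rfl⟩
    exact (hpe i).symm

theorem cfc_diagonal_ofReal (f : ℝ → ℝ) (a : n → ℝ) :
    cfc f (diagonal fun i => (a i : ℂ)) = diagonal fun i => (f (a i) : ℂ) := by
  simpa using cfc_conj_diagonal f a 1

end Matrix

/-! ### Loewner's inequality -/

open Matrix in
/-- Two systems of vectors with the same Gram matrix: if `diag α` is below `diag β` on them, then
`f (diag α)` is below `f (diag β)` on them. -/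
theorem IsMatrixMonotoneOn.posSemidef_sub_of_gram_eq {m : ℕ} {f : ℝ → ℝ} {J : Set ℝ}
    (hf : IsMatrixMonotoneOn m J f) {α β : Fin m → ℝ} (hα : ∀ i, α i ∈ J) (hβ : ∀ i, β i ∈ J)
    {P Q : Matrix (Fin m) (Fin m) ℂ} (hP : IsUnit P) (hPQ : Pᴴ * P = Qᴴ * Q)
    (h : (Pᴴ * diagonal (fun i => (β i : ℂ)) * P -
      Qᴴ * diagonal (fun i => (α i : ℂ)) * Q).PosSemidef) :
    (Pᴴ * diagonal (fun i => (f (β i) : ℂ)) * P -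
      Qᴴ * diagonal (fun i => (f (α i) : ℂ)) * Q).PosSemidef := by
  obtain ⟨R, hR1, hR2⟩ : ∃ R : Matrix (Fin m) (Fin m) ℂ, P * R = 1 ∧ R * P = 1 :=
    ⟨(hP.unit⁻¹ : (Matrix (Fin m) (Fin m) ℂ)ˣ), hP.mul_val_inv, hP.val_inv_mul⟩
  have hR1' : Rᴴ * Pᴴ = 1 := by rw [← conjTranspose_mul, hR1, conjTranspose_one]
  have hR2' : Pᴴ * Rᴴ = 1 := by rw [← conjTranspose_mul, hR2, conjTranspose_one]
  -- Since R = P⁻¹, equality of the Gram matrices says that Q P⁻¹ is unitary. Congruence by R thus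
  -- compares diag β with a unitary conjugate of diag α, where monotonicity applies; congruence by P
  -- goes back.
  have hU : (Q * R)ᴴ * (Q * R) = 1 := by
    rw [conjTranspose_mul, Matrix.mul_assoc, ← Matrix.mul_assoc Qᴴ, ← hPQ, Matrix.mul_assoc,
      hR1, Matrix.mul_one, hR1']
  have hU' : (Q * R) * (Q * R)ᴴ = 1 := mul_eq_one_comm.mp hU
  let V : unitary (Matrix (Fin m) (Fin m) ℂ) := ⟨(Q * R)ᴴ, by
    rw [Unitary.mem_iff]
    simp only [star_eq_conjTranspose, conjTranspose_conjTranspose]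
    exact ⟨hU', hU⟩⟩
  have key : ∀ g : Fin m → ℝ, (V : Matrix (Fin m) (Fin m) ℂ) * diagonal (fun i => (g i : ℂ)) *
      star (V : Matrix (Fin m) (Fin m) ℂ) = Rᴴ * (Qᴴ * diagonal (fun i => (g i : ℂ)) * Q) * R := by
    intro g
    simp only [V, star_eq_conjTranspose, conjTranspose_conjTranspose, conjTranspose_mul]
    simp only [Matrix.mul_assoc]
  have conj : ∀ g g' : Fin m → ℝ, diagonal (fun i => (g i : ℂ)) -
      (V : Matrix (Fin m) (Fin m) ℂ) * diagonal (fun i => (g' i : ℂ)) *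
        star (V : Matrix (Fin m) (Fin m) ℂ) =
      Rᴴ * (Pᴴ * diagonal (fun i => (g i : ℂ)) * P -
        Qᴴ * diagonal (fun i => (g' i : ℂ)) * Q) * R := by
    intro g g'
    rw [key, Matrix.mul_sub, Matrix.sub_mul]
    congr 1
    rw [Matrix.mul_assoc Pᴴ, ← Matrix.mul_assoc Rᴴ, hR1', Matrix.one_mul, Matrix.mul_assoc, hR1,
      Matrix.mul_one]
  have hA := isHermitian_diagonal_ofReal α
  have hpos := hf ((V : Matrix (Fin m) (Fin m) ℂ) * diagonal (fun i => (α i : ℂ)) *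
      star (V : Matrix (Fin m) (Fin m) ℂ)) (diagonal fun i => (β i : ℂ))
    (IsSelfAdjoint.conjugate (R := Matrix (Fin m) (Fin m) ℂ) hA _) (isHermitian_diagonal_ofReal β)
    (by
      rw [Unitary.spectrum_star_right_conjugate, spectrum_real_diagonal]
      rintro _ ⟨i, rfl⟩
      exact hα i)
    (by
      rw [spectrum_real_diagonal]
      rintro _ ⟨i, rfl⟩
      exact hβ i)
    (by
      rw [conj]
      exact h.conjTranspose_mul_mul_same R)
  rw [cfc_conj_diagonal, cfc_diagonal_ofReal, conj] at hpos
  have := hpos.conjTranspose_mul_mul_same P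
  rwa [Matrix.mul_assoc, Matrix.mul_assoc _ R P, hR2, Matrix.mul_one, ← Matrix.mul_assoc, hR2',
    Matrix.one_mul] at this

namespace Lagrange

theorem nodalWeight_univ_eq_prod_ite {ι : Type*} [Fintype ι] [DecidableEq ι] (v : ι → ℝ) (x : ι) :
    nodalWeight Finset.univ v x = ∏ j, if j = x then 1 else (v x - v j)⁻¹ := by
  rw [nodalWeight, ← Finset.mul_prod_erase Finset.univ _ (Finset.mem_univ x), if_pos rfl, one_mul]
  exact Finset.prod_congr rfl fun j hj => (if_neg (Finset.ne_of_mem_erase hj)).symm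

theorem sum_nodalWeight_mul_eval {ι : Type*} [DecidableEq ι] {s : Finset ι} {v : ι → ℝ}
    (hv : InjOn v s) {p : Polynomial ℝ} (hp : p.degree < s.card) :
    ∑ i ∈ s, nodalWeight s v i * p.eval (v i) = p.coeff (s.card - 1) := by
  rw [coeff_eq_sum hv hp]
  refine Finset.sum_congr rfl fun i _ => ?_
  rw [nodalWeight, Finset.prod_inv_distrib, div_eq_mul_inv, mul_comm]

variable {m : ℕ} {α β : Fin m → ℝ}

theorem injective_sumElim_of_interlacing (hlt : ∀ k, α k < β k)
    (hdis : ∀ j k, j < k → β j < α k) : Function.Injective (Sum.elim α β) := by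
  refine Function.Injective.sumElim ?_ ?_ ?_
  · intro j k h
    rcases lt_trichotomy j k with hjk | hjk | hjk
    · linarith [hdis j k hjk, hlt j]
    · exact hjk
    · linarith [hdis k j hjk, hlt k]
  · intro j k h
    rcases lt_trichotomy j k with hjk | hjk | hjk
    · linarith [hdis j k hjk, hlt k]
    · exact hjk
    · linarith [hdis k j hjk, hlt j]
  · intro j k h
    rcases lt_trichotomy j k with hjk | hjk | hjk
    · linarith [hdis j k hjk, hlt k, hlt j]
    · subst hjk
      linarith [hlt j]
    · linarith [hdis k j hjk, hlt j]

/-- For j ≠ k, the node β k lies outside [α j, β j], so the factors from α j and β j have the same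
sign; only β k - α k > 0 is left unpaired. For α k the unpaired factor is negative. -/
theorem nodalWeight_inr_pos (hlt : ∀ k, α k < β k) (hdis : ∀ j k, j < k → β j < α k) (k : Fin m) :
    0 < nodalWeight Finset.univ (Sum.elim α β) (Sum.inr k) := by
  rw [nodalWeight_univ_eq_prod_ite, Fintype.prod_sum_type, ← Finset.prod_mul_distrib]
  refine Finset.prod_pos fun j _ => ?_
  simp only [reduceCtorEq, if_false, Sum.elim_inr, Sum.elim_inl, Sum.inr.injEq]
  rcases lt_trichotomy j k with hjk | hjk | hjk
  · rw [if_neg hjk.ne, ← mul_inv]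
    have := hdis j k hjk
    exact inv_pos.2 (mul_pos (by linarith [hlt j, hlt k]) (by linarith [hlt j, hlt k]))
  · subst hjk
    simpa using hlt j
  · rw [if_neg hjk.ne', ← mul_inv]
    have := hdis k j hjk
    exact inv_pos.2 (mul_pos_of_neg_of_neg (by linarith [hlt j, hlt k]) (by linarith [hlt j, hlt k]))

theorem nodalWeight_inl_neg (hlt : ∀ k, α k < β k) (hdis : ∀ j k, j < k → β j < α k) (k : Fin m) :
    nodalWeight Finset.univ (Sum.elim α β) (Sum.inl k) < 0 := by
  rw [nodalWeight_univ_eq_prod_ite, Fintype.prod_sum_type, ← Finset.prod_mul_distrib,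
    ← Finset.mul_prod_erase Finset.univ _ (Finset.mem_univ k)]
  refine mul_neg_of_neg_of_pos ?_ (Finset.prod_pos fun j hj => ?_)
  · simpa using hlt k
  simp only [reduceCtorEq, if_false, Sum.elim_inr, Sum.elim_inl, Sum.inl.injEq]
  rw [if_neg (Finset.ne_of_mem_erase hj), ← mul_inv]
  rcases lt_or_gt_of_ne (Finset.ne_of_mem_erase hj) with hjk | hjk
  · have := hdis j k hjk
    exact inv_pos.2 (mul_pos (by linarith [hlt j, hlt k]) (by linarith [hlt j, hlt k]))
  · have := hdis k j hjk
    exact inv_pos.2 (mul_pos_of_neg_of_neg (by linarith [hlt j, hlt k]) (by linarith [hlt j, hlt k]))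

end Lagrange

open Matrix Lagrange in
/-- **Loewner's inequality** for interlacing nodes. -/
theorem IsMatrixMonotoneOn.sum_nodalWeight_nonneg_of_interlacing {m : ℕ} {f : ℝ → ℝ} {J : Set ℝ}
    (hf : IsMatrixMonotoneOn m J f) {α β : Fin m → ℝ} (hα : ∀ i, α i ∈ J) (hβ : ∀ i, β i ∈ J)
    (hlt : ∀ k, α k < β k) (hdis : ∀ j k, j < k → β j < α k) {q : Polynomial ℝ}
    (hq : q.degree < m) :
    0 ≤ ∑ x, nodalWeight Finset.univ (Sum.elim α β) x *
      (f (Sum.elim α β x) * q.eval (Sum.elim α β x) ^ 2) := by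
  set v := Sum.elim α β with hv
  set w := nodalWeight Finset.univ v with hw
  have hinj : Function.Injective v := injective_sumElim_of_interlacing hlt hdis
  have hwr : ∀ k, 0 < w (Sum.inr k) := nodalWeight_inr_pos hlt hdis
  have hwl : ∀ k, w (Sum.inl k) < 0 := nodalWeight_inl_neg hlt hdis
  have hcard : (Finset.univ : Finset (Fin m ⊕ Fin m)).card = m + m := by simp
  -- The divided difference of a monomial over 2m nodes picks out the coefficient of degree 2m - 1.
  have hpow : ∀ n, n < m + m → ∑ x, w x * v x ^ n = if n = m + m - 1 then 1 else 0 := by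
    intro n hn
    have h := sum_nodalWeight_mul_eval (s := Finset.univ) (hinj.injOn) (p := Polynomial.X ^ n)
      (by rw [hcard, Polynomial.degree_X_pow]; exact_mod_cast hn)
    rw [hcard, Polynomial.coeff_X_pow] at h
    simpa [eq_comm] using h
  -- The signs of the weights split a divided difference into a form on the β nodes minus one on the
  -- α nodes, each factored by a scaled Vandermonde matrix.
  let P : Matrix (Fin m) (Fin m) ℂ := of fun i j => ((√(w (Sum.inr i)) * β i ^ (j : ℕ) : ℝ) : ℂ)
  let Q : Matrix (Fin m) (Fin m) ℂ := of fun i j => ((√(-w (Sum.inl i)) * α i ^ (j : ℕ) : ℝ) : ℂ)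
  have entry : ∀ g : ℝ → ℝ, Pᴴ * diagonal (fun i => (g (β i) : ℂ)) * P -
      Qᴴ * diagonal (fun i => (g (α i) : ℂ)) * Q =
      of fun j l : Fin m => ((∑ x, w x * (g (v x) * v x ^ ((j : ℕ) + l)) : ℝ) : ℂ) := by
    intro g
    ext j l
    rw [Matrix.sub_apply, Matrix.mul_apply, mul_apply, of_apply, Fintype.sum_sum_type]
    push_cast
    rw [add_comm, ← sub_neg_eq_add, ← Finset.sum_neg_distrib]
    congr 1
    · refine Finset.sum_congr rfl fun i _ => ?_
      have h2 : ((√(w (Sum.inr i)) : ℝ) : ℂ) * (√(w (Sum.inr i)) : ℝ) = (w (Sum.inr i) : ℝ) := by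
        rw [← Complex.ofReal_mul, Real.mul_self_sqrt (hwr i).le]
      simp only [mul_diagonal, conjTranspose_apply, P, of_apply, Complex.star_def,
        Complex.conj_ofReal]
      rw [← h2]
      simp only [hv, Sum.elim_inr]
      push_cast
      ring
    · refine Finset.sum_congr rfl fun i _ => ?_
      have h2 : ((√(-w (Sum.inl i)) : ℝ) : ℂ) * (√(-w (Sum.inl i)) : ℝ) =
          -(w (Sum.inl i) : ℝ) := by
        rw [← Complex.ofReal_mul, Real.mul_self_sqrt (by linarith [hwl i])]
        push_cast
        rfl
      simp only [mul_diagonal, conjTranspose_apply, Q, of_apply, Complex.star_def,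
        Complex.conj_ofReal]
      rw [← neg_mul, ← h2]
      simp only [hv, Sum.elim_inl]
      push_cast
      ring
  have hPunit : IsUnit P := by
    rw [isUnit_iff_isUnit_det]
    have : P = diagonal (fun i => ((√(w (Sum.inr i)) : ℝ) : ℂ)) *
        vandermonde (fun i => (β i : ℂ)) := by
      ext i j
      simp [P, diagonal_mul, vandermonde_apply]
    rw [this, det_mul, det_diagonal]
    refine (mul_ne_zero (Finset.prod_ne_zero_iff.2 fun i _ => ?_) ?_).isUnit
    · exact Complex.ofReal_ne_zero.2 (Real.sqrt_pos.2 (hwr i)).ne'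
    · rw [det_vandermonde_ne_zero_iff]
      intro i j hij
      exact Sum.inr_injective (hinj (Complex.ofReal_injective hij))
  have hgram : Pᴴ * P = Qᴴ * Q := by
    have h1 := entry fun _ => 1
    simp only [Complex.ofReal_one, diagonal_one, Matrix.mul_one, one_mul] at h1
    rw [← sub_eq_zero, h1]
    ext j l
    rw [of_apply, hpow _ (by omega), if_neg (by omega)]
    simp
  have hshift : (Pᴴ * diagonal (fun i => (β i : ℂ)) * P -
      Qᴴ * diagonal (fun i => (α i : ℂ)) * Q).PosSemidef := by
    have h1 := entry fun t => t
    beta_reduce at h1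
    rw [h1]
    -- The exponent j + l + 1 reaches 2m - 1 only at j = l = m - 1, so this is a rank one
    -- projection; without the shift it is never reached, whence the equal Gram matrices.
    have : (of fun j l : Fin m => ((∑ x, w x * (v x * v x ^ ((j : ℕ) + l)) : ℝ) : ℂ)) =
        vecMulVec (fun j : Fin m => if (j : ℕ) + 1 = m then (1 : ℂ) else 0)
          (star fun j : Fin m => if (j : ℕ) + 1 = m then (1 : ℂ) else 0) := by
      ext j l
      simp only [of_apply, vecMulVec_apply, Pi.star_apply, ← pow_succ']
      rw [hpow _ (by omega)]
      have := j.2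
      have := l.2
      by_cases hj : (j : ℕ) + 1 = m <;> by_cases hl : (l : ℕ) + 1 = m
      · rw [if_pos (by omega), if_pos hj, if_pos hl]; simp
      · rw [if_neg (by omega), if_neg hl]; simp
      · rw [if_neg (by omega), if_neg hj]; simp
      · rw [if_neg (by omega), if_neg hj]; simp
    rw [this]
    exact posSemidef_vecMulVec_self_star _
  have hpos := hf.posSemidef_sub_of_gram_eq hα hβ hPunit hgram hshift
  rw [entry f] at hpos
  have h := hpos.dotProduct_mulVec_nonneg fun j : Fin m => ((q.coeff j : ℝ) : ℂ)
  have heval : ∀ x, q.eval (v x) = ∑ j : Fin m, q.coeff j * v x ^ (j : ℕ) := by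
    intro x
    rw [Fin.sum_univ_eq_sum_range (fun j => q.coeff j * v x ^ j) m]
    by_cases hq0 : q = 0
    · simp [hq0]
    · exact Polynomial.eval_eq_sum_range' ((Polynomial.natDegree_lt_iff_degree_lt hq0).2 hq) _
  convert Complex.zero_le_real.1 (h.trans_eq _) using 1
  simp only [dotProduct, mulVec, of_apply, Pi.star_apply, Complex.star_def, Complex.conj_ofReal]
  norm_cast
  simp only [heval, sq, Finset.mul_sum, Finset.sum_mul]
  rw [Finset.sum_comm]
  conv_rhs => rw [Finset.sum_comm]
  refine Finset.sum_congr rfl fun j _ => ?_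
  conv_rhs => rw [Finset.sum_comm]
  refine Finset.sum_congr rfl fun l _ => Finset.sum_congr rfl fun x _ => ?_
  ring

theorem Lagrange.nodalWeight_map {ι κ : Type*} [DecidableEq ι] [DecidableEq κ] (s : Finset κ)
    (e : κ ↪ ι) (v : ι → ℝ) (x : κ) :
    Lagrange.nodalWeight (s.map e) v (e x) = Lagrange.nodalWeight s (v ∘ e) x := by
  rw [Lagrange.nodalWeight, Lagrange.nodalWeight, ← Finset.map_erase, Finset.prod_map]
  rfl

open Lagrange in
/-- **Loewner's inequality**: nonnegativity of weighted divided differences of `f` times a square. -/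
theorem IsMatrixMonotoneOn.sum_nodalWeight_nonneg {m : ℕ} {f : ℝ → ℝ} {J : Set ℝ}
    (hf : IsMatrixMonotoneOn m J f) {s : Finset ℝ} (hs : ∀ t ∈ s, t ∈ J) (hcard : s.card = 2 * m)
    {q : Polynomial ℝ} (hq : q.degree < m) :
    0 ≤ ∑ t ∈ s, nodalWeight s id t * (f t * q.eval t ^ 2) := by
  let e := s.orderEmbOfFin hcard
  let α : Fin m → ℝ := fun k => e ⟨2 * k, by omega⟩
  let β : Fin m → ℝ := fun k => e ⟨2 * k + 1, by omega⟩
  have hlt : ∀ k, α k < β k := fun k => e.strictMono (by simp [Fin.lt_def])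
  have hdis : ∀ j k, j < k → β j < α k := fun j k h => e.strictMono (by
    rw [Fin.lt_def] at h ⊢
    simp only
    omega)
  have hαs : ∀ k, α k ∈ s := fun k => s.orderEmbOfFin_mem hcard _
  have hβs : ∀ k, β k ∈ s := fun k => s.orderEmbOfFin_mem hcard _
  have key := hf.sum_nodalWeight_nonneg_of_interlacing (fun k => hs _ (hαs k))
    (fun k => hs _ (hβs k)) hlt hdis hq
  let v : Fin m ⊕ Fin m ↪ ℝ := ⟨Sum.elim α β, injective_sumElim_of_interlacing hlt hdis⟩
  have hmap : Finset.univ.map v = s := by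
    refine Finset.eq_of_subset_of_card_le ?_ (by simp [hcard, two_mul])
    intro t ht
    obtain ⟨x, -, rfl⟩ := Finset.mem_map.1 ht
    rcases x with k | k
    · exact hαs k
    · exact hβs k
  rw [← hmap, Finset.sum_map]
  simp only [nodalWeight_map]
  exact key

/-! ### Polynomials nonnegative on a half-line -/

namespace Polynomial

/-- The sums of polynomials `q ^ 2` and `X * q ^ 2` of degree at most `d`. -/
noncomputable def halfLineSquares (d : ℕ) : AddSubmonoid (Polynomial ℝ) :=
  AddSubmonoid.closure {p | ∃ q : Polynomial ℝ,
    (p = q ^ 2 ∧ 2 * q.natDegree ≤ d) ∨ (p = X * q ^ 2 ∧ 2 * q.natDegree + 1 ≤ d)}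

theorem sq_mem_halfLineSquares {d : ℕ} {q : Polynomial ℝ} (h : 2 * q.natDegree ≤ d) :
    q ^ 2 ∈ halfLineSquares d :=
  AddSubmonoid.subset_closure ⟨q, .inl ⟨rfl, h⟩⟩

theorem X_mul_sq_mem_halfLineSquares {d : ℕ} {q : Polynomial ℝ} (h : 2 * q.natDegree + 1 ≤ d) :
    X * q ^ 2 ∈ halfLineSquares d :=
  AddSubmonoid.subset_closure ⟨q, .inr ⟨rfl, h⟩⟩

theorem halfLineSquares_mono {d e : ℕ} (h : d ≤ e) : halfLineSquares d ≤ halfLineSquares e := by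
  refine AddSubmonoid.closure_mono ?_
  rintro p ⟨q, ⟨hp, hq⟩ | ⟨hp, hq⟩⟩
  · exact ⟨q, .inl ⟨hp, hq.trans h⟩⟩
  · exact ⟨q, .inr ⟨hp, hq.trans h⟩⟩

theorem mul_mem_halfLineSquares {d e : ℕ} {p p' : Polynomial ℝ} (hp : p ∈ halfLineSquares d)
    (hp' : p' ∈ halfLineSquares e) : p * p' ∈ halfLineSquares (d + e) := by
  induction hp using AddSubmonoid.closure_induction with
  | zero => simp [zero_mem]
  | add x y _ _ hx hy => rw [add_mul]; exact add_mem hx hy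
  | mem x hx =>
    induction hp' using AddSubmonoid.closure_induction with
    | zero => simp [zero_mem]
    | add y z _ _ hy hz => rw [mul_add]; exact add_mem hy hz
    | mem y hy =>
      obtain ⟨q, ⟨rfl, hq⟩ | ⟨rfl, hq⟩⟩ := hx <;> obtain ⟨r, ⟨rfl, hr⟩ | ⟨rfl, hr⟩⟩ := hy <;>
        have hqr := natDegree_mul_le (p := q) (q := r)
      · rw [← mul_pow]
        exact sq_mem_halfLineSquares (by omega)
      · rw [mul_left_comm, ← mul_pow]
        exact X_mul_sq_mem_halfLineSquares (by omega)
      · rw [mul_assoc, ← mul_pow]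
        exact X_mul_sq_mem_halfLineSquares (by omega)
      · rw [show X * q ^ 2 * (X * r ^ 2) = (X * (q * r)) ^ 2 by ring]
        have := natDegree_mul_le (p := (X : Polynomial ℝ)) (q := q * r)
        rw [natDegree_X] at this
        exact sq_mem_halfLineSquares (by omega)

theorem C_mem_halfLineSquares {c : ℝ} (hc : 0 ≤ c) (d : ℕ) : C c ∈ halfLineSquares d := by
  rw [← Real.sq_sqrt hc, C_pow]
  exact sq_mem_halfLineSquares (by simp)

/-- A real polynomial that is nonnegative on a half-line is a sum of squares and of `X` times
squares, without cancellation of degrees. -/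
theorem mem_halfLineSquares_of_nonneg (p : Polynomial ℝ) (hp : ∀ x, 0 < x → 0 ≤ p.eval x) :
    p ∈ halfLineSquares p.natDegree := by
  induction hd : p.natDegree using Nat.strong_induction_on generalizing p with
  | _ d ih =>
  subst hd
  by_cases h0 : p.natDegree = 0
  · rw [eq_C_of_natDegree_eq_zero h0] at hp ⊢
    exact C_mem_halfLineSquares (by simpa using hp 1 one_pos) _
  have hpne : p ≠ 0 := fun h => h0 (by simp [h])
  -- it is enough to split off a factor of positive degree
  have split : ∀ a b : Polynomial ℝ, p = a * b → a ∈ halfLineSquares a.natDegree →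
      a.natDegree ≠ 0 → (∀ x, 0 < x → 0 ≤ b.eval x) → p ∈ halfLineSquares p.natDegree := by
    intro a b hab ha ha0 hb
    have hne : a * b ≠ 0 := hab ▸ hpne
    have hdeg : p.natDegree = a.natDegree + b.natDegree := by
      rw [hab, natDegree_mul (left_ne_zero_of_mul hne) (right_ne_zero_of_mul hne)]
    rw [hdeg, hab]
    exact mul_mem_halfLineSquares ha (ih _ (by omega) b hb rfl)
  obtain ⟨z, hz⟩ := IsAlgClosed.exists_aeval_eq_zero ℂ p
    (fun h => h0 (natDegree_eq_zero_iff_degree_le_zero.2 h.le))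
  by_cases him : z.im = 0
  · obtain ⟨r, rfl⟩ : ∃ r : ℝ, z = r := ⟨z.re, Complex.ext rfl (by simpa using him)⟩
    have hroot : p.IsRoot r := by
      have : aeval ((algebraMap ℝ ℂ) r) p = 0 := hz
      rw [aeval_algebraMap_apply] at this
      simpa using this
    obtain ⟨p₁, rfl⟩ := dvd_iff_isRoot.2 hroot
    rcases le_or_gt r 0 with hr | hr
    -- For r ≤ 0 the factor is X · 1² + (-r).
    · refine split _ _ rfl ?_ (by simp) fun x hx => ?_
      · rw [natDegree_X_sub_C]
        have h1 : X * (1 : Polynomial ℝ) ^ 2 ∈ halfLineSquares 1 :=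
          X_mul_sq_mem_halfLineSquares (by simp)
        have h2 := add_mem h1 (C_mem_halfLineSquares (neg_nonneg.2 hr) 1)
        simpa [sub_eq_add_neg] using h2
      · have := hp x hx
        rw [eval_mul, eval_sub, eval_X, eval_C] at this
        exact nonneg_of_mul_nonneg_right this (by linarith)
    -- At a positive root p cannot change sign, so the cofactor is nonpositive to the left and
    -- nonnegative to the right of r: the root is at least double.
    · have hr1 : p₁.IsRoot r := by
        have hc : Tendsto (fun x => p₁.eval x) (𝓝 r) (𝓝 (p₁.eval r)) := p₁.continuous.tendsto r
        refine le_antisymm ?_ ?_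
        · refine le_of_tendsto (hc.mono_left (nhdsWithin_le_nhds (s := Iio r))) ?_
          filter_upwards [Ioo_mem_nhdsLT hr] with x hx
          have := hp x hx.1
          rw [eval_mul, eval_sub, eval_X, eval_C] at this
          nlinarith [hx.2]
        · refine ge_of_tendsto (hc.mono_left (nhdsWithin_le_nhds (s := Ioi r))) ?_
          filter_upwards [self_mem_nhdsWithin] with x hx
          have hx : r < x := hx
          have := hp x (hr.trans hx)
          rw [eval_mul, eval_sub, eval_X, eval_C] at this
          exact nonneg_of_mul_nonneg_right this (by linarith)
      obtain ⟨p₂, rfl⟩ := dvd_iff_isRoot.2 hr1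
      have hne : ∀ x, 0 < x → x ≠ r → 0 ≤ p₂.eval x := by
        intro x hx hxr
        have := hp x hx
        rw [← mul_assoc, eval_mul, eval_mul, eval_sub, eval_X, eval_C] at this
        exact nonneg_of_mul_nonneg_right this (mul_self_pos.2 (sub_ne_zero.2 hxr))
      refine split ((X - C r) ^ 2) p₂ (by ring) ?_ (by simp) fun x hx => ?_
      · exact sq_mem_halfLineSquares (by simp)
      · by_cases hxr : x = r
        · subst hxr
          refine ge_of_tendsto ((p₂.continuous.tendsto x).mono_left
            (nhdsWithin_le_nhds (s := Ioi x))) ?_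
          filter_upwards [self_mem_nhdsWithin] with y hy
          exact hne y (hx.trans hy) (ne_of_gt hy)
        · exact hne x hx hxr
  · obtain ⟨b, hb⟩ := quadratic_dvd_of_aeval_eq_zero_im_ne_zero p hz him
    have hquad : X ^ 2 - C (2 * z.re) * X + C (‖z‖ ^ 2) = (X - C z.re) ^ 2 + C (z.im ^ 2) := by
      rw [← Complex.normSq_eq_norm_sq, Complex.normSq_apply]
      simp only [C_mul, C_add, C_pow, map_ofNat]
      ring
    rw [hquad] at hb
    have hdeg : ((X - C z.re) ^ 2 + C (z.im ^ 2)).natDegree = 2 := by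
      rw [natDegree_add_C]
      simp
    refine split _ b hb ?_ (by omega) fun x hx => ?_
    · rw [hdeg]
      exact add_mem (sq_mem_halfLineSquares (by simp)) (C_mem_halfLineSquares (sq_nonneg _) _)
    · have := hp x hx
      rw [hb, eval_mul] at this
      refine nonneg_of_mul_nonneg_right this ?_
      simp only [eval_add, eval_pow, eval_sub, eval_X, eval_C]
      positivity

end Polynomial

/-! ### Loewner's inequality with a node at 0 or at infinity -/

namespace Lagrange

theorem nodalWeight_insert_of_mem {s : Finset ℝ} {a t : ℝ} (ha : a ∉ s) (ht : t ∈ s) :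
    nodalWeight (insert a s) id t = (t - a)⁻¹ * nodalWeight s id t := by
  have hat : a ≠ t := fun h => ha (h ▸ ht)
  rw [nodalWeight, Finset.erase_insert_of_ne hat,
    Finset.prod_insert fun h => ha (Finset.mem_of_mem_erase h)]
  rfl

theorem nodalWeight_insert_self {s : Finset ℝ} {a : ℝ} (ha : a ∉ s) :
    nodalWeight (insert a s) id a = ∏ t ∈ s, (a - t)⁻¹ := by
  rw [nodalWeight, Finset.erase_insert ha]
  rfl

end Lagrange

open Lagrange

/-- A matrix monotone function of degree 2 grows at most linearly. -/
theorem IsMatrixMonotoneOn.le_mul_of_one_lt {f : ℝ → ℝ} (hf : IsMatrixMonotoneOn 2 (Ici 0) f)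
    (hf0 : 0 ≤ f 0) {T : ℝ} (hT : 1 < T) : f T ≤ (2 * T - 1) * f 1 := by
  -- The polynomial q vanishes at the auxiliary node 2T, so f(2T) drops out.
  have h := hf.sum_nodalWeight_nonneg_of_interlacing (α := ![0, T]) (β := ![1, 2 * T])
    (q := Polynomial.X - Polynomial.C (2 * T))
    (by simp [Fin.forall_fin_two]; linarith) (by simp [Fin.forall_fin_two]; linarith)
    (by simp [Fin.forall_fin_two]; linarith) (by simp [Fin.forall_fin_two]; linarith)
    (by rw [Polynomial.degree_X_sub_C]; norm_num)
  simp only [nodalWeight_univ_eq_prod_ite, Fintype.prod_sum_type, Fintype.sum_sum_type,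
    Fin.prod_univ_two, Fin.sum_univ_two] at h
  simp at h
  have h1 : T - 1 ≠ 0 := by linarith
  have h2 : T ≠ 0 := by linarith
  have h3 : 1 - 2 * T ≠ 0 := by linarith
  rw [show T - 2 * T = -T by ring, show 1 - T = -(T - 1) by ring] at h
  have h4 := mul_nonneg (sub_pos.2 hT).le h
  have h5 : (T - 1) * (-(T⁻¹ * (T⁻¹ * 2⁻¹) * (f 0 * (2 * T) ^ 2)) +
      T⁻¹ * ((T - 1)⁻¹ * (-T)⁻¹) * (f T * (-T) ^ 2) +
      (-(T - 1))⁻¹ * (1 - 2 * T)⁻¹ * (f 1 * (1 - 2 * T) ^ 2)) =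
      (2 * T - 1) * f 1 - f T - 2 * (T - 1) * f 0 := by
    field_simp
    ring
  rw [h5] at h4
  have := mul_nonneg (sub_pos.2 hT).le hf0
  linarith

/-- Adding the node 0 divides the weight at t by t. The weight of 0 itself is negative, being a
product of an odd number of negative factors, so its term may be dropped as f(0) ≥ 0. -/
theorem IsMatrixMonotoneOn.sum_sq_nonneg {f : ℝ → ℝ} {m : ℕ}
    (hf : IsMatrixMonotoneOn (m + 1) (Ici 0) f) (hf0 : 0 ≤ f 0)
    {s : Finset ℝ} (hs : ∀ t ∈ s, 0 < t) (hcard : s.card = 2 * m + 1) {q : Polynomial ℝ}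
    (hq : q.natDegree ≤ m) :
    0 ≤ ∑ t ∈ s, nodalWeight s id t * (f t * (q.eval t ^ 2 / t)) := by
  have h0 : (0 : ℝ) ∉ s := fun h => (hs 0 h).false
  have key := hf.sum_nodalWeight_nonneg (s := insert 0 s) (q := q)
    (by
      intro t ht
      rcases Finset.mem_insert.1 ht with rfl | ht
      · exact mem_Ici.2 le_rfl
      · exact (hs t ht).le)
    (by rw [Finset.card_insert_of_notMem h0, hcard]; ring)
    (Polynomial.degree_le_natDegree.trans_lt (by exact_mod_cast Nat.lt_succ_of_le hq))
  rw [Finset.sum_insert h0, nodalWeight_insert_self h0] at key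
  have hneg : ∏ t ∈ s, (0 - t)⁻¹ ≤ 0 := by
    simp only [zero_sub, inv_neg]
    rw [Finset.prod_neg, hcard, Odd.neg_one_pow ⟨m, rfl⟩]
    have := Finset.prod_nonneg fun t ht => (inv_pos.2 (hs t ht)).le
    linarith
  have hterm := mul_nonneg hf0 (sq_nonneg (q.eval 0))
  have hle := mul_nonpos_of_nonpos_of_nonneg hneg hterm
  have hsum : ∑ t ∈ s, nodalWeight (insert 0 s) id t * (f t * q.eval t ^ 2) =
      ∑ t ∈ s, nodalWeight s id t * (f t * (q.eval t ^ 2 / t)) := by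
    refine Finset.sum_congr rfl fun t ht => ?_
    rw [nodalWeight_insert_of_mem h0 ht, sub_zero]
    ring
  linarith

/-- Add a node T and let T → ∞ after multiplying by T: the old weights acquire T / (t - T) → -1,
which reverses the sign. The term at T vanishes in the limit because f grows at most linearly and 2
+ 2 deg q ≤ 2m < 2m + 1. -/
theorem IsMatrixMonotoneOn.sum_sq_nonpos {f : ℝ → ℝ} {m : ℕ}
    (hf : IsMatrixMonotoneOn (m + 1) (Ici 0) f) {C : ℝ} (hf0 : ∀ t, 0 ≤ t → 0 ≤ f t)
    (hC : ∀ t, 1 < t → f t ≤ C * t)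
    {s : Finset ℝ} (hs : ∀ t ∈ s, 0 < t) (hcard : s.card = 2 * m + 1) {q : Polynomial ℝ}
    (hq : q.natDegree + 1 ≤ m) :
    ∑ t ∈ s, nodalWeight s id t * (f t * q.eval t ^ 2) ≤ 0 := by
  have ev : ∀ᶠ T : ℝ in atTop, 0 ≤ f T / T * ((Polynomial.X ^ 2 * q ^ 2).eval T /
      (nodal s id).eval T) + ∑ t ∈ s, T / (t - T) *
        (nodalWeight s id t * (f t * q.eval t ^ 2)) := by
    filter_upwards [eventually_gt_atTop 1, (eventually_all_finset s).2
      fun t _ => eventually_gt_atTop t] with T hT1 hT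
    have hTs : T ∉ s := fun h => (hT T h).false
    have key := hf.sum_nodalWeight_nonneg (s := insert T s) (q := q)
      (by
        intro t ht
        rcases Finset.mem_insert.1 ht with rfl | ht
        · exact mem_Ici.2 (by linarith)
        · exact (hs t ht).le)
      (by rw [Finset.card_insert_of_notMem hTs, hcard]; ring)
      (Polynomial.degree_le_natDegree.trans_lt (by exact_mod_cast (by omega)))
    rw [Finset.sum_insert hTs, nodalWeight_insert_self hTs] at key
    refine (mul_nonneg (by linarith : (0 : ℝ) ≤ T) key).trans_eq ?_
    rw [mul_add, Finset.mul_sum]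
    congr 1
    · rw [eval_nodal, Finset.prod_inv_distrib]
      simp only [Polynomial.eval_mul, Polynomial.eval_pow, Polynomial.eval_X, id]
      have : T ≠ 0 := by linarith
      field_simp
    · refine Finset.sum_congr rfl fun t ht => ?_
      rw [nodalWeight_insert_of_mem hTs ht]
      ring
  have lim1 : Tendsto (fun T : ℝ => f T / T * ((Polynomial.X ^ 2 * q ^ 2).eval T /
      (nodal s id).eval T)) atTop (𝓝 0) := by
    have hz := Polynomial.div_tendsto_atTop_zero_of_degree_lt (Polynomial.X ^ 2 * q ^ 2) (nodal s id) (by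
      rw [degree_nodal, hcard]
      refine Polynomial.degree_le_natDegree.trans_lt ?_
      have h1 := Polynomial.natDegree_mul_le (p := (Polynomial.X : Polynomial ℝ) ^ 2) (q := q ^ 2)
      rw [Polynomial.natDegree_X_pow, Polynomial.natDegree_pow] at h1
      exact_mod_cast (by omega))
    refine bdd_le_mul_tendsto_zero' C ?_ hz
    filter_upwards [eventually_gt_atTop 1] with T hT
    have hT0 : 0 < T := by linarith
    rw [abs_of_nonneg (div_nonneg (hf0 T hT0.le) hT0.le), div_le_iff₀ hT0]
    exact hC T hT
  have lim2 : ∀ t : ℝ, Tendsto (fun T : ℝ => T / (t - T)) atTop (𝓝 (-1)) := by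
    intro t
    have h1 : Tendsto (fun T : ℝ => t * T⁻¹ - 1) atTop (𝓝 (t * 0 - 1)) :=
      (tendsto_inv_atTop_zero.const_mul t).sub_const 1
    have h2 := h1.inv₀ (by norm_num)
    norm_num at h2
    refine h2.congr' ?_
    filter_upwards [eventually_gt_atTop 0] with T hT
    rw [← inv_div]
    congr 1
    field_simp
  have lim := lim1.add (tendsto_finsetSum s fun t _ =>
    (lim2 t).mul_const (nodalWeight s id t * (f t * q.eval t ^ 2)))
  have := ge_of_tendsto lim ev
  simp only [neg_mul, one_mul, zero_add, Finset.sum_neg_distrib] at this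
  linarith

theorem Polynomial.eval_comp_neg_X (q : Polynomial ℝ) (t : ℝ) :
    (q.comp (-Polynomial.X)).eval t = q.eval (-t) := by
  simp

/-- At -t, the generators q² and X q², divided by t, become q(-t)²/t and -q(-t)²: exactly the
inequalities for a node at 0 and at infinity. -/
theorem IsOperatorMonotoneOn.sum_eval_neg_nonneg {f : ℝ → ℝ}
    (hf : IsOperatorMonotoneOn (Ici 0) f) (hf0 : ∀ t, 0 ≤ t → 0 ≤ f t)
    {s : Finset ℝ} (hs : ∀ t ∈ s, 0 < t) {m : ℕ} (hcard : s.card = 2 * m + 1) {p : Polynomial ℝ}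
    (hp : p ∈ Polynomial.halfLineSquares (2 * m)) :
    0 ≤ ∑ t ∈ s, nodalWeight s id t * (f t * (p.eval (-t) / t)) := by
  have hC : ∀ t, 1 < t → f t ≤ 2 * f 1 * t := by
    intro t ht
    have := (hf 2).le_mul_of_one_lt (hf0 0 le_rfl) ht
    have := hf0 1 zero_le_one
    nlinarith
  have hdeg : ∀ q : Polynomial ℝ, (q.comp (-Polynomial.X)).natDegree = q.natDegree := by
    intro q
    rw [Polynomial.natDegree_comp, Polynomial.natDegree_neg, Polynomial.natDegree_X, mul_one]
  induction hp using AddSubmonoid.closure_induction with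
  | zero => simp
  | add p p' _ _ h h' =>
    refine (add_nonneg h h').trans_eq ?_
    rw [← Finset.sum_add_distrib]
    refine Finset.sum_congr rfl fun t _ => ?_
    rw [Polynomial.eval_add]
    ring
  | mem p hp =>
    obtain ⟨q, ⟨rfl, hq⟩ | ⟨rfl, hq⟩⟩ := hp
    · refine ((hf (m + 1)).sum_sq_nonneg (hf0 0 le_rfl) hs hcard
        (q := q.comp (-Polynomial.X)) (by rw [hdeg]; omega)).trans_eq ?_
      simp only [Polynomial.eval_comp_neg_X, Polynomial.eval_pow]
    · refine (neg_nonneg.2 ((hf (m + 1)).sum_sq_nonpos hf0 hC hs hcard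
        (q := q.comp (-Polynomial.X)) (by rw [hdeg]; omega))).trans_eq ?_
      rw [← Finset.sum_neg_distrib]
      refine Finset.sum_congr rfl fun t ht => ?_
      have := (hs t ht).ne'
      simp only [Polynomial.eval_comp_neg_X, Polynomial.eval_pow, Polynomial.eval_mul,
        Polynomial.eval_X]
      field_simp

/-! ### Positivity on linear combinations of the kernels -/

-- Multiplying the combination by ∏ (x + u) / (1 + x) gives a polynomial p ≥ 0 on (0, ∞). At -t only
-- one summand of p survives, and its product is the inverse of the nodal weight: the odd number of
-- nodes makes the signs cancel. So the sum for p is ∑ c f.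
open Polynomial in
theorem IsOperatorMonotoneOn.sum_mul_nonneg_of_odd {f : ℝ → ℝ}
    (hf : IsOperatorMonotoneOn (Ici 0) f) (hf0 : ∀ t, 0 ≤ t → 0 ≤ f t)
    {s : Finset ℝ} (hs : ∀ t ∈ s, 0 < t) {m : ℕ} (hcard : s.card = 2 * m + 1) {c : ℝ → ℝ}
    (hc : ∀ x, 0 < x → 0 ≤ ∑ t ∈ s, c t * (t * (1 + x) / (t + x))) :
    0 ≤ ∑ t ∈ s, c t * f t := by
  set p : ℝ[X] := ∑ t ∈ s, C (c t * t) * ∏ u ∈ s.erase t, (X + C u) with hp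
  have hdeg : p.natDegree ≤ 2 * m := by
    refine natDegree_sum_le_of_forall_le _ _ fun t ht => (natDegree_C_mul_le _ _).trans ?_
    refine (natDegree_prod_le _ _).trans ?_
    simp [Finset.card_erase_of_mem ht, hcard]
  have heval : ∀ x, p.eval x = ∑ t ∈ s, c t * t * ∏ u ∈ s.erase t, (x + u) := by
    intro x
    simp [hp, eval_finsetSum, eval_prod]
  have hpos : ∀ x, 0 < x → 0 ≤ p.eval x := by
    intro x hx
    have hprod : 0 < ∏ u ∈ s, (x + u) := Finset.prod_pos fun u hu => by linarith [hs u hu]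
    have hx1 : 0 < 1 + x := by linarith
    refine (mul_nonneg (div_nonneg hprod.le hx1.le) (hc x hx)).trans_eq ?_
    rw [heval, Finset.mul_sum]
    refine Finset.sum_congr rfl fun t ht => ?_
    rw [← Finset.mul_prod_erase s _ ht]
    have : x + t ≠ 0 := by linarith [hs t ht]
    rw [add_comm t x]
    field_simp
  have key := hf.sum_eval_neg_nonneg hf0 hs hcard
    (halfLineSquares_mono hdeg (mem_halfLineSquares_of_nonneg p hpos))
  refine key.trans_eq (Finset.sum_congr rfl fun t ht => ?_)
  have hsum : p.eval (-t) = c t * t * ∏ u ∈ s.erase t, (-t + u) := by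
    rw [heval]
    refine Finset.sum_eq_single_of_mem t ht fun u hu hut => ?_
    rw [Finset.prod_eq_zero (Finset.mem_erase.2 ⟨hut.symm, ht⟩) (by ring), mul_zero]
  have hneg : ∏ u ∈ s.erase t, (-t + u) = ∏ u ∈ s.erase t, (t - u) := by
    rw [← one_mul (∏ u ∈ s.erase t, (t - u)),
      ← Even.neg_one_pow (n := (s.erase t).card) (by simp [Finset.card_erase_of_mem ht, hcard]),
      ← Finset.prod_neg]
    exact Finset.prod_congr rfl fun u _ => by ring
  have hne : ∏ u ∈ s.erase t, (t - u) ≠ 0 :=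
    Finset.prod_ne_zero_iff.2 fun u hu => sub_ne_zero.2 (Finset.ne_of_mem_erase hu).symm
  have ht0 := (hs t ht).ne'
  rw [hsum, hneg, nodalWeight, Finset.prod_inv_distrib]
  simp only [id]
  field_simp

/-- A linear inequality between the functions `t ↦ t (1 + x) / (t + x)` is inherited by every
nonnegative operator monotone function. -/
theorem IsOperatorMonotoneOn.sum_mul_nonneg {f : ℝ → ℝ}
    (hf : IsOperatorMonotoneOn (Ici 0) f) (hf0 : ∀ t, 0 ≤ t → 0 ≤ f t)
    {s : Finset ℝ} (hs : ∀ t ∈ s, 0 < t) {c : ℝ → ℝ}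
    (hc : ∀ x, 0 < x → 0 ≤ ∑ t ∈ s, c t * (t * (1 + x) / (t + x))) :
    0 ≤ ∑ t ∈ s, c t * f t := by
  rcases Nat.even_or_odd' s.card with ⟨m, hm | hm⟩
  -- An extra node with coefficient 0 makes the number of nodes odd.
  · obtain ⟨a, ha0, has⟩ : ∃ a, 0 < a ∧ a ∉ s := by
      have := (Ioi_infinite (0 : ℝ)).exists_notMem_finset s
      simpa using this
    have hca : ∀ g : ℝ → ℝ, ∑ t ∈ insert a s, (if t = a then 0 else c t) * g t =
        ∑ t ∈ s, c t * g t := by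
      intro g
      rw [Finset.sum_insert has, if_pos rfl, zero_mul, zero_add]
      exact Finset.sum_congr rfl fun t ht => by rw [if_neg (ne_of_mem_of_not_mem ht has)]
    rw [← hca]
    refine hf.sum_mul_nonneg_of_odd hf0 (m := m) (c := fun t => if t = a then 0 else c t) ?_ ?_ ?_
    · intro t ht
      rcases Finset.mem_insert.1 ht with rfl | ht
      · exact ha0
      · exact hs t ht
    · rw [Finset.card_insert_of_notMem has, hm]
    · intro x hx
      rw [hca fun t => t * (1 + x) / (t + x)]
      exact hc x hx
  · exact hf.sum_mul_nonneg_of_odd hf0 hs hm hc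

/-! ### The moment problem on a compact space -/

/-- A version of the theorems of M. Riesz and Riesz–Markov–Kakutani: the moment problem with data
`F` is solvable if every nonnegative combination of the moment functions has a nonnegative value. -/
theorem exists_measure_forall_integral_eq {X ι : Type*} [TopologicalSpace X] [CompactSpace X]
    [T2Space X] [MeasurableSpace X] [BorelSpace X] (Φ : ι → C(X, ℝ)) (F : ι → ℝ)
    (hpos : ∀ c : ι →₀ ℝ, (∀ x, 0 ≤ ∑ i ∈ c.support, c i * Φ i x) →
      0 ≤ ∑ i ∈ c.support, c i * F i)
    (hone : ∃ i, Φ i = 1) :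
    ∃ μ : Measure X, IsFiniteMeasure μ ∧ ∀ i, ∫ x, Φ i x ∂μ = F i := by
  let L : (ι →₀ ℝ) →ₗ[ℝ] C(X, ℝ) := Finsupp.linearCombination ℝ Φ
  let G : (ι →₀ ℝ) →ₗ[ℝ] ℝ := Finsupp.linearCombination ℝ F
  have hL : ∀ c x, L c x = ∑ i ∈ c.support, c i * Φ i x := by
    intro c x
    simp [L, Finsupp.linearCombination_apply, Finsupp.sum, ContinuousMap.sum_apply]
  have hGpos : ∀ c, 0 ≤ L c → 0 ≤ G c := by
    intro c hc
    have := hpos c fun x => by rw [← hL]; exact hc x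
    simpa [G, Finsupp.linearCombination_apply, Finsupp.sum] using this
  obtain ⟨S, hS⟩ := L.rangeRestrict.exists_rightInverse_of_surjective L.range_rangeRestrict
  have hLS : ∀ y : LinearMap.range L, L (S y) = y := fun y =>
    congrArg Subtype.val (LinearMap.congr_fun hS y)
  have hGS : ∀ c, G (S (L.rangeRestrict c)) = G c := by
    intro c
    -- Positivity applied to an element of the kernel of L and to its negative shows that G vanishes
    -- there, so G descends to the range of L.
    have h : L (S (L.rangeRestrict c) - c) = 0 := by
      rw [map_sub, hLS]
      simp
    have h1 := hGpos _ h.ge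
    have h2 := hGpos (-(S (L.rangeRestrict c) - c)) (by rw [map_neg, h, neg_zero])
    rw [map_neg, map_sub] at h2
    rw [map_sub] at h1
    linarith
  obtain ⟨i₀, hi₀⟩ := hone
  -- The constant 1 lies in the range, and ‖y‖ · 1 + y ≥ 0 gives the cofinality that the extension
  -- theorem needs.
  obtain ⟨g, hg, hg0⟩ := riesz_extension (PointedCone.positive ℝ C(X, ℝ))
    ⟨LinearMap.range L, G ∘ₗ S⟩ (fun y hy => hGpos _ (by rw [hLS]; exact hy)) (fun y => by
      refine ⟨L.rangeRestrict (Finsupp.single i₀ ‖y‖), ?_⟩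
      rw [PointedCone.mem_positive]
      intro x
      have h1 : L (Finsupp.single i₀ ‖y‖) x = ‖y‖ := by simp [L, hi₀]
      have h2 := neg_le_of_abs_le (y.norm_coe_le_norm x)
      change 0 ≤ L (Finsupp.single i₀ ‖y‖) x + y x
      linarith)
  let T : CompactlySupportedContinuousMap X ℝ →ₗ[ℝ] C(X, ℝ) :=
    { toFun := fun h => h.toContinuousMap
      map_add' := fun _ _ => rfl
      map_smul' := fun _ _ => rfl }
  let Λ : CompactlySupportedContinuousMap X ℝ →ₚ[ℝ] ℝ :=
    PositiveLinearMap.mk₀ (g ∘ₗ T) fun h hh => hg0 _ ((PointedCone.mem_positive ..).2 fun x => hh x)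
  refine ⟨RealRMK.rieszMeasure Λ, inferInstance, fun i => ?_⟩
  let Ψ : CompactlySupportedContinuousMap X ℝ :=
    ⟨Φ i, HasCompactSupport.of_compactSpace _⟩
  refine (RealRMK.integral_rieszMeasure Λ Ψ).trans ?_
  have h1 := hg (L.rangeRestrict (Finsupp.single i 1))
  change g (L (Finsupp.single i 1)) = G (S (L.rangeRestrict (Finsupp.single i 1))) at h1
  rw [hGS] at h1
  change g (Φ i) = F i
  simpa [L, G] using h1

/-! ### The kernel on [0, ∞] and existence of the measure -/

/-- The function `(t, x) ↦ (t + x)⁻¹` for `t ∈ (0, ∞)` and `x ∈ [0, ∞]`. -/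
noncomputable def resolventENNReal (t : Ioi (0 : ℝ)) (x : ℝ≥0∞) : ℝ :=
  (ENNReal.ofReal t + x)⁻¹.toReal

theorem continuous_resolventENNReal :
    Continuous fun p : Ioi (0 : ℝ) × ℝ≥0∞ => resolventENNReal p.1 p.2 := by
  unfold resolventENNReal
  refine ENNReal.continuousOn_toReal.comp_continuous ?_ fun p => ?_
  · exact ((ENNReal.continuous_ofReal.comp (continuous_subtype_val.comp continuous_fst)).add
      continuous_snd).inv
  · have : 0 < ENNReal.ofReal p.1 := ENNReal.ofReal_pos.2 p.1.2
    simp only [mem_ofPred_eq, ne_eq, ENNReal.inv_eq_top, add_eq_zero, not_and_or]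
    exact Or.inl this.ne'

theorem resolventENNReal_top (t : Ioi (0 : ℝ)) : resolventENNReal t ∞ = 0 := by
  simp [resolventENNReal]

theorem resolventENNReal_of_ne_top (t : Ioi (0 : ℝ)) {x : ℝ≥0∞} (hx : x ≠ ∞) :
    resolventENNReal t x = ((t : ℝ) + x.toReal)⁻¹ := by
  rw [resolventENNReal, ENNReal.toReal_inv, ENNReal.toReal_add ENNReal.ofReal_ne_top hx,
    ENNReal.toReal_ofReal (le_of_lt t.2)]

/-- This absorbs the special values at 0 and ∞ into one continuous expression. -/
theorem phi_eq_resolventENNReal (t : Ioi (0 : ℝ)) (x : ℝ≥0∞) :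
    phi t x = t + t * (1 - t) * resolventENNReal t x := by
  have ht : (0 : ℝ) < t := t.2
  unfold phi
  split_ifs with h0 hi
  · subst h0
    rw [resolventENNReal_of_ne_top t ENNReal.zero_ne_top]
    simp only [ENNReal.toReal_zero, add_zero]
    field_simp
    ring
  · rw [hi, resolventENNReal_top, mul_zero, add_zero]
  · rw [resolventENNReal_of_ne_top t hi]
    have : (t : ℝ) + x.toReal ≠ 0 := by
      have := x.toReal_nonneg
      linarith
    field_simp
    ring

theorem continuous_phi (t : Ioi (0 : ℝ)) : Continuous (phi t) := by
  rw [funext (phi_eq_resolventENNReal t)]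
  exact continuous_const.add (continuous_const.mul
    (continuous_resolventENNReal.comp (f := fun x => (t, x)) (by fun_prop)))

theorem abs_phi_le {t : ℝ} (ht : 0 ≤ t) (x : ℝ≥0∞) : |phi t x| ≤ 1 + t := by
  unfold phi
  split_ifs with h0 hi
  · simpa using ht
  · rw [abs_of_nonneg ht]
    linarith
  · have hx : 0 < x.toReal := ENNReal.toReal_pos h0 hi
    rw [abs_of_nonneg (by positivity), div_le_iff₀ (by positivity)]
    nlinarith [mul_nonneg ht ht]

theorem phi_zero_left (x : ℝ≥0∞) : phi 0 x = if x = 0 then 1 else 0 := by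
  simp [phi]

theorem phi_of_pos_of_lt_top (t : ℝ) {x : ℝ≥0∞} (hx : x ≠ 0) (hx' : x ≠ ∞) :
    phi t x = t * (1 + x.toReal) / (t + x.toReal) := by
  rw [phi, if_neg hx, if_neg hx']

theorem tendsto_integral_phi_zero (m : Measure ℝ≥0∞) [IsFiniteMeasure m] :
    Tendsto (fun t => ∫ x, phi t x ∂m) (𝓝[>] 0) (𝓝 (∫ x, phi 0 x ∂m)) := by
  refine tendsto_integral_filter_of_dominated_convergence (fun _ => 2) ?_ ?_
    (integrable_const _) (ae_of_all _ fun x => ?_)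
  · filter_upwards [self_mem_nhdsWithin] with t ht
    exact (integrable_phi m t (le_of_lt ht)).aestronglyMeasurable
  · filter_upwards [Ioo_mem_nhdsGT one_pos] with t ht
    exact ae_of_all _ fun x => (abs_phi_le ht.1.le x).trans (by linarith [ht.2])
  · refine Tendsto.mono_left ?_ nhdsWithin_le_nhds
    refine ContinuousAt.tendsto (f := fun t => phi t x) ?_
    unfold phi
    split_ifs with h0 hi
    · exact continuousAt_const
    · exact continuousAt_id
    · have : (0 : ℝ) + x.toReal ≠ 0 := by simpa using (ENNReal.toReal_pos h0 hi).ne'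
      fun_prop (disch := assumption)

theorem IsOperatorMonotoneOn.exists_isRepresentedBy {f : ℝ → ℝ}
    (hf : IsOperatorMonotoneOn (Ici 0) f) (hcont : ContinuousOn f (Ici 0))
    (hf0 : ∀ t, 0 ≤ t → 0 ≤ f t) :
    ∃ m : Measure ℝ≥0∞, IsFiniteMeasure m ∧ IsRepresentedBy f m := by
  obtain ⟨m, hm, h⟩ := exists_measure_forall_integral_eq
    (fun t : Ioi (0 : ℝ) => (⟨phi t, continuous_phi t⟩ : C(ℝ≥0∞, ℝ))) (fun t => f t) (by
      intro c hc
      classical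
      let c' : ℝ → ℝ := fun t => if h : 0 < t then c ⟨t, h⟩ else 0
      have hc' : ∀ t : Ioi (0 : ℝ), c' t = c t := fun t => dif_pos t.2
      have hsum : ∀ g : ℝ → ℝ, ∑ t ∈ c.support.map (Function.Embedding.subtype _), c' t * g t =
          ∑ t ∈ c.support, c t * g t := by
        intro g
        rw [Finset.sum_map]
        exact Finset.sum_congr rfl fun t _ => by rw [← hc']; rfl
      rw [← hsum]
      refine hf.sum_mul_nonneg hf0 ?_ fun x hx => ?_
      · intro t ht
        obtain ⟨u, -, rfl⟩ := Finset.mem_map.1 ht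
        exact u.2
      · rw [hsum fun t => t * (1 + x) / (t + x)]
        refine (hc (ENNReal.ofReal x)).trans_eq (Finset.sum_congr rfl fun t _ => ?_)
        change c t * phi t _ = _
        rw [phi_of_pos_of_lt_top _ (ENNReal.ofReal_pos.2 hx).ne' ENNReal.ofReal_ne_top,
          ENNReal.toReal_ofReal hx.le])
    ⟨⟨1, mem_Ioi.2 one_pos⟩, by
      ext x
      change phi ((⟨1, mem_Ioi.2 one_pos⟩ : Ioi (0 : ℝ)) : ℝ) x = 1
      rw [phi_eq_resolventENNReal]
      simp⟩
  refine ⟨m, hm, fun t ht => ?_⟩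
  rcases ht.eq_or_lt with rfl | ht
  -- The kernel at t = 0 is the indicator of {0}, which is discontinuous, so the moment problem
  -- covers only t > 0; continuity of f and dominated convergence supply t = 0.
  · have h1 := tendsto_integral_phi_zero m
    have h2 : Tendsto f (𝓝[>] 0) (𝓝 (f 0)) :=
      (hcont 0 (mem_Ici.2 le_rfl)).tendsto.mono_left (nhdsWithin_mono _ Ioi_subset_Ici_self)
    refine tendsto_nhds_unique h2 (h1.congr' ?_)
    filter_upwards [self_mem_nhdsWithin] with t ht
    exact h ⟨t, ht⟩
  · exact (h ⟨t, ht⟩).symm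

/-! ### Represented functions are operator monotone -/

namespace Matrix

variable {n : Type*} [Fintype n] [DecidableEq n]

/-- The spectral measure of a Hermitian matrix at a vector. -/
theorem IsHermitian.exists_dotProduct_cfc_eq {A : Matrix n n ℂ} (hA : A.IsHermitian) (x : n → ℂ) :
    ∃ c : n → ℝ, (∀ i, 0 ≤ c i) ∧ ∀ g : ℝ → ℝ,
      star x ⬝ᵥ (cfc g A *ᵥ x) = ((∑ i, g (hA.eigenvalues i) * c i : ℝ) : ℂ) := by
  obtain ⟨U, hU⟩ : ∃ U : Matrix n n ℂ, U = hA.eigenvectorUnitary := ⟨_, rfl⟩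
  refine ⟨fun i => Complex.normSq ((Uᴴ *ᵥ x) i), fun i => Complex.normSq_nonneg _, fun g => ?_⟩
  rw [hA.cfc_eq, IsHermitian.cfc, Unitary.conjStarAlgAut_apply, ← hU, ← mulVec_mulVec,
    ← mulVec_mulVec, dotProduct_mulVec, star_eq_conjTranspose,
    show star x ᵥ* U = star (Uᴴ *ᵥ x) by rw [star_mulVec, conjTranspose_conjTranspose]]
  simp only [dotProduct, mulVec_diagonal, Pi.star_apply]
  push_cast
  refine Finset.sum_congr rfl fun i _ => ?_
  rw [Complex.normSq_eq_conj_mul_self, mul_left_comm]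
  rfl

theorem continuousOn_spectrum (A : Matrix n n ℂ) (g : ℝ → ℝ) : ContinuousOn g (spectrum ℝ A) :=
  A.finite_real_spectrum.continuousOn g

theorem IsHermitian.posSemidef_cfc {A : Matrix n n ℂ} (hA : A.IsHermitian) {g : ℝ → ℝ}
    (hg : ∀ t ∈ spectrum ℝ A, 0 ≤ g t) : (cfc g A).PosSemidef := by
  refine PosSemidef.of_dotProduct_mulVec_nonneg (cfc_predicate g A) fun x => ?_
  obtain ⟨c, hc, h⟩ := hA.exists_dotProduct_cfc_eq x
  rw [h]
  exact Complex.zero_le_real.2 (Finset.sum_nonneg fun i _ =>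
    mul_nonneg (hg _ (hA.eigenvalues_mem_spectrum_real i)) (hc i))

/-- The resolvent `A ↦ (A + x)⁻¹` is antitone on positive semidefinite matrices. -/
theorem posSemidef_cfc_inv_sub_cfc_inv {A B : Matrix n n ℂ} (hA : A.IsHermitian)
    (hB : B.IsHermitian) (hA0 : spectrum ℝ A ⊆ Ici 0) (hB0 : spectrum ℝ B ⊆ Ici 0)
    (hAB : (B - A).PosSemidef) {x : ℝ} (hx : 0 < x) :
    (cfc (fun t => (t + x)⁻¹) A - cfc (fun t => (t + x)⁻¹) B).PosSemidef := by
  have inv_mul : ∀ {M : Matrix n n ℂ}, M.IsHermitian → spectrum ℝ M ⊆ Ici 0 →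
      cfc (fun t => (t + x)⁻¹) M * (M + algebraMap ℝ _ x) = 1 := by
    intro M hM hM0
    have hM' : IsSelfAdjoint M := hM
    have h1 : M + algebraMap ℝ _ x = cfc (fun t => t + x) M := by
      rw [cfc_add_const x (fun t => t) M (continuousOn_spectrum M _) hM', cfc_id' ℝ M hM']
    rw [h1, ← cfc_mul _ _ M (continuousOn_spectrum M _) (continuousOn_spectrum M _),
      ← cfc_const_one ℝ M hM']
    refine cfc_congr fun t ht => ?_
    have : t + x ≠ 0 := by
      have : 0 ≤ t := hM0 ht
      linarith
    exact inv_mul_cancel₀ this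
  set R := cfc (fun t => (t + x)⁻¹) A with hR
  set S := cfc (fun t => (t + x)⁻¹) B with hS
  have hRA := inv_mul hA hA0
  have hSB := inv_mul hB hB0
  have hAR := mul_eq_one_comm.mp hRA
  have hRS : R - S = S * (B - A) * R := by
    rw [← add_sub_add_right_eq_sub B A (algebraMap ℝ _ x), Matrix.mul_sub, hSB, Matrix.sub_mul,
      Matrix.one_mul, Matrix.mul_assoc, hAR, Matrix.mul_one]
  have hSR : R - S = R * (B - A) * S := by
    rw [← add_sub_add_right_eq_sub B A (algebraMap ℝ _ x), Matrix.mul_sub, hRA, Matrix.sub_mul,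
      Matrix.one_mul, Matrix.mul_assoc, mul_eq_one_comm.mp hSB, Matrix.mul_one]
  have hSh : Sᴴ = S := cfc_predicate (R := ℝ) (p := IsSelfAdjoint) (fun t => (t + x)⁻¹) B
  have hRpos : R.PosSemidef := hA.posSemidef_cfc fun t ht =>
    inv_nonneg.2 (add_nonneg (hA0 ht) hx.le)
  have e : R - S = Sᴴ * (B - A) * S + ((B - A) * S)ᴴ * R * ((B - A) * S) := by
    rw [conjTranspose_mul, hAB.isHermitian.eq, hSh, hRS]
    -- Substituting one form of the resolvent identity into the other gives S(B - A)S + S(B - A)R(B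
    -- - A)S, both terms of which are positive semidefinite.
    conv_lhs => rw [show R = S + R * (B - A) * S by rw [← hSR]; abel]
    rw [Matrix.mul_add]
    simp only [Matrix.mul_assoc]
  rw [e]
  exact (hAB.conjTranspose_mul_mul_same S).add (hRpos.conjTranspose_mul_mul_same _)

end Matrix

open Matrix in
theorem IsRepresentedBy.isOperatorMonotoneOn {f : ℝ → ℝ} {m : Measure ℝ≥0∞} [IsFiniteMeasure m]
    (h : IsRepresentedBy f m) : IsOperatorMonotoneOn (Ici 0) f := by
  intro n A B hA hB hA0 hB0 hAB
  refine PosSemidef.of_dotProduct_mulVec_nonneg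
    (IsHermitian.sub (cfc_predicate f B) (cfc_predicate f A)) fun x => ?_
  obtain ⟨c, -, hcA⟩ := hA.exists_dotProduct_cfc_eq x
  obtain ⟨d, -, hdB⟩ := hB.exists_dotProduct_cfc_eq x
  have hA0' : ∀ i, 0 ≤ hA.eigenvalues i := fun i => hA0 (hA.eigenvalues_mem_spectrum_real i)
  have hB0' : ∀ i, 0 ≤ hB.eigenvalues i := fun i => hB0 (hB.eigenvalues_mem_spectrum_real i)
  have hsa : IsSelfAdjoint A := hA
  have hsb : IsSelfAdjoint B := hB
  have hone : ∑ i, d i = ∑ i, c i := by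
    have h1 := hcA fun _ => 1
    have h2 := hdB fun _ => 1
    rw [cfc_const_one ℝ A hsa] at h1
    rw [cfc_const_one ℝ B hsb, h1] at h2
    simpa using (Complex.ofReal_injective h2).symm
  have hid : ∑ i, hA.eigenvalues i * c i ≤ ∑ i, hB.eigenvalues i * d i := by
    have h1 := hcA fun t => t
    have h2 := hdB fun t => t
    have h3 := hAB.dotProduct_mulVec_nonneg x
    rw [cfc_id' ℝ A hsa] at h1
    rw [cfc_id' ℝ B hsb] at h2
    rw [sub_mulVec, dotProduct_sub, h1, h2, ← Complex.ofReal_sub, Complex.zero_le_real] at h3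
    exact sub_nonneg.1 h3
  have hinv : ∀ y, 0 < y → ∑ i, (hB.eigenvalues i + y)⁻¹ * d i ≤
      ∑ i, (hA.eigenvalues i + y)⁻¹ * c i := by
    intro y hy
    have h3 := (posSemidef_cfc_inv_sub_cfc_inv hA hB hA0 hB0 hAB hy).dotProduct_mulVec_nonneg x
    rw [sub_mulVec, dotProduct_sub, hcA, hdB, ← Complex.ofReal_sub, Complex.zero_le_real] at h3
    exact sub_nonneg.1 h3
  -- For 0 < y < ∞ the kernel is (1 + y) - y(1 + y)(t + y)⁻¹: the total masses agree and the
  -- resolvent is antitone.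
  have hphi : ∀ y, ∑ i, phi (hA.eigenvalues i) y * c i ≤ ∑ i, phi (hB.eigenvalues i) y * d i := by
    intro y
    by_cases h0 : y = 0
    · simp [phi, h0, hone]
    by_cases hi : y = ∞
    · simpa [phi, hi] using hid
    have hy := ENNReal.toReal_pos h0 hi
    have e : ∀ t, 0 ≤ t → ∀ a, phi t y * a = (1 + y.toReal) * a -
        y.toReal * (1 + y.toReal) * ((t + y.toReal)⁻¹ * a) := by
      intro t ht a
      rw [phi_of_pos_of_lt_top t h0 hi]
      have : t + y.toReal ≠ 0 := by linarith
      field_simp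
      ring
    simp only [e _ (hA0' _), e _ (hB0' _), Finset.sum_sub_distrib, ← Finset.mul_sum, hone]
    have := mul_le_mul_of_nonneg_left (hinv _ hy)
      (mul_nonneg hy.le (by linarith : 0 ≤ 1 + y.toReal))
    linarith
  have hint : ∀ (a : Fin n → ℝ) (e : Fin n → ℝ), (∀ i, 0 ≤ a i) →
      ∑ i, f (a i) * e i = ∫ y, ∑ i, phi (a i) y * e i ∂m := by
    intro a e ha
    rw [integral_finsetSum _ fun i _ => (integrable_phi m _ (ha i)).mul_const _]
    exact Finset.sum_congr rfl fun i _ => by rw [integral_mul_const, h _ (ha i)]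
  rw [sub_mulVec, dotProduct_sub, hcA, hdB, ← Complex.ofReal_sub, Complex.zero_le_real, sub_nonneg,
    hint _ _ hA0', hint _ _ hB0']
  exact integral_mono
    (integrable_finsetSum _ fun i _ => (integrable_phi m _ (hA0' i)).mul_const _)
    (integrable_finsetSum _ fun i _ => (integrable_phi m _ (hB0' i)).mul_const _) hphi

/-! ### Uniqueness of the measure -/

theorem ContinuousMap.integrable_of_compactSpace {X : Type*} [TopologicalSpace X] [CompactSpace X]
    [MeasurableSpace X] [BorelSpace X] (μ : Measure X) [IsFiniteMeasure μ] (g : C(X, ℝ)) :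
    Integrable g μ :=
  (BoundedContinuousFunction.mkOfCompact g).integrable μ

theorem ContinuousMap.continuous_integral {X : Type*} [TopologicalSpace X] [CompactSpace X]
    [MeasurableSpace X] [BorelSpace X] (μ : Measure X) [IsFiniteMeasure μ] :
    Continuous fun g : C(X, ℝ) => ∫ x, g x ∂μ := by
  refine (LipschitzWith.of_dist_le_mul (K := μ.real univ |>.toNNReal) fun g h => ?_).continuous
  rw [dist_eq_norm, dist_eq_norm, Real.coe_toNNReal _ measureReal_nonneg,
    ← integral_sub (g.integrable_of_compactSpace μ) (h.integrable_of_compactSpace μ), mul_comm]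
  exact norm_integral_le_of_norm_le_const (ae_of_all _ fun x => (g - h).norm_coe_le_norm x)

/-- The family of functions `x ↦ (t + x)⁻¹` on `[0, ∞]`, continuous in `t`. -/
noncomputable def resolventMap : C(Ioi (0 : ℝ), C(ℝ≥0∞, ℝ)) :=
  ContinuousMap.curry ⟨_, continuous_resolventENNReal⟩

theorem resolventMap_apply (t : Ioi (0 : ℝ)) (x : ℝ≥0∞) :
    resolventMap t x = resolventENNReal t x := rfl

theorem resolventMap_sub (t s : Ioi (0 : ℝ)) :
    resolventMap t - resolventMap s = ((s : ℝ) - t) • (resolventMap t * resolventMap s) := by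
  ext x
  simp only [ContinuousMap.sub_apply, ContinuousMap.smul_apply, ContinuousMap.mul_apply,
    resolventMap_apply, smul_eq_mul]
  by_cases hx : x = ∞
  · simp [hx, resolventENNReal_top]
  · rw [resolventENNReal_of_ne_top t hx, resolventENNReal_of_ne_top s hx]
    have h0 := x.toReal_nonneg
    have h1 : (t : ℝ) + x.toReal ≠ 0 := by
      have : (0 : ℝ) < t := t.2
      linarith
    have h2 : (s : ℝ) + x.toReal ≠ 0 := by
      have : (0 : ℝ) < s := s.2
      linarith
    field_simp
    ring

theorem resolventMap_injective (t : Ioi (0 : ℝ)) : Function.Injective (resolventMap t) := by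
  have hne : ∀ x : ℝ≥0∞, (ENNReal.ofReal t + x)⁻¹ ≠ ∞ := by
    intro x
    have : 0 < ENNReal.ofReal t := ENNReal.ofReal_pos.2 t.2
    simp only [ne_eq, ENNReal.inv_eq_top, add_eq_zero, not_and_or]
    exact Or.inl this.ne'
  intro x y hxy
  have h := (ENNReal.toReal_eq_toReal_iff' (hne x) (hne y)).1 hxy
  exact (ENNReal.add_right_inj ENNReal.ofReal_ne_top).1 (inv_injective h)

theorem eq_zero_of_eq_zero_of_ne {h : Ioi (0 : ℝ) → ℝ} (hc : Continuous h) {t : Ioi (0 : ℝ)}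
    (h0 : ∀ s, s ≠ t → h s = 0) : h t = 0 :=
  congrFun (hc.ext_on (dense_compl_singleton t) continuous_const h0) t

/-- A continuous linear functional on `C([0, ∞])` that vanishes on `1` and on all `(t + x)⁻¹` is
zero. -/
theorem eq_zero_of_apply_resolventMap_eq_zero (I : C(ℝ≥0∞, ℝ) →L[ℝ] ℝ) (hone : I 1 = 0)
    (hI : ∀ t, I (resolventMap t) = 0) : I = 0 := by
  have hpow : ∀ k t, I (resolventMap t ^ (k + 1)) = 0 := by
    intro k
    induction k with
    | zero => simpa using hI
    | succ k ih =>
      intro t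
      -- This is differentiation in t without derivatives: the difference of the (k + 1)-st powers
      -- at t and s is s - t times the displayed argument of I, and s → t leaves (k + 1) times the
      -- next power.
      have h := eq_zero_of_eq_zero_of_ne (t := t) (h := fun s =>
        I (resolventMap t * resolventMap s * ∑ i ∈ Finset.range (k + 1),
          resolventMap t ^ i * resolventMap s ^ (k + 1 - 1 - i))) (by fun_prop) fun s hs => by
        have h1 := (Commute.all (resolventMap t) (resolventMap s)).mul_geom_sum₂ (k + 1)
        rw [resolventMap_sub, smul_mul_assoc] at h1
        have h2 := congrArg I h1
        rw [map_smul, map_sub, ih, ih, sub_zero] at h2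
        exact (smul_eq_zero.1 h2).resolve_left (sub_ne_zero.2 fun h => hs (Subtype.ext h))
      rw [geom_sum₂_self, ← mul_assoc, mul_comm _ ((_ : ℕ) : C(ℝ≥0∞, ℝ)), mul_assoc,
        ← nsmul_eq_mul, map_nsmul] at h
      have h3 := (smul_eq_zero.1 h).resolve_left k.succ_ne_zero
      rw [Nat.add_sub_cancel] at h3
      rw [show resolventMap t ^ (k + 1 + 1) = resolventMap t * resolventMap t * resolventMap t ^ k
        by ring]
      exact h3
  let t₀ : Ioi (0 : ℝ) := ⟨1, mem_Ioi.2 one_pos⟩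
  -- Stone–Weierstrass: a single resolvent is injective on [0, ∞], so it separates points.
  have hdense := ContinuousMap.subalgebra_topologicalClosure_eq_top_of_separatesPoints
    (Algebra.adjoin ℝ {resolventMap t₀}) fun x y hxy =>
      ⟨_, ⟨resolventMap t₀, Algebra.subset_adjoin rfl, rfl⟩, (resolventMap_injective t₀).ne hxy⟩
  have hadj : ∀ g ∈ Algebra.adjoin ℝ {resolventMap t₀}, I g = 0 := by
    intro g hg
    rw [Algebra.adjoin_singleton_eq_range_aeval] at hg
    obtain ⟨p, rfl⟩ := hg
    rw [AlgHom.toRingHom_eq_coe, RingHom.coe_coe, Polynomial.aeval_eq_sum_range, map_sum]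
    refine Finset.sum_eq_zero fun k _ => ?_
    rw [map_smul]
    cases k with
    | zero => rw [pow_zero, hone, smul_zero]
    | succ k => rw [hpow, smul_zero]
  ext g
  have hg : g ∈ (Algebra.adjoin ℝ {resolventMap t₀}).topologicalClosure := by
    rw [hdense]
    trivial
  exact closure_minimal (t := {g | I g = 0}) hadj (isClosed_eq I.continuous continuous_const) hg

theorem IsRepresentedBy.unique {f : ℝ → ℝ} {m₁ m₂ : Measure ℝ≥0∞} [IsFiniteMeasure m₁]
    [IsFiniteMeasure m₂] (h₁ : IsRepresentedBy f m₁) (h₂ : IsRepresentedBy f m₂) : m₁ = m₂ := by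
  let I : C(ℝ≥0∞, ℝ) →L[ℝ] ℝ :=
    { toFun := fun g => ∫ x, g x ∂m₁ - ∫ x, g x ∂m₂
      map_add' := fun g h => by
        simp only [ContinuousMap.add_apply]
        rw [integral_add (g.integrable_of_compactSpace _) (h.integrable_of_compactSpace _),
          integral_add (g.integrable_of_compactSpace _) (h.integrable_of_compactSpace _)]
        ring
      map_smul' := fun c g => by
        simp only [ContinuousMap.smul_apply, integral_smul, smul_sub, RingHom.id_apply]
      cont := (ContinuousMap.continuous_integral m₁).sub (ContinuousMap.continuous_integral m₂) }
  have hphi : ∀ t : Ioi (0 : ℝ),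
      (t : ℝ) * I 1 + t * (1 - t) * I (resolventMap t) = 0 := by
    intro t
    have h0 : I ((t : ℝ) • (1 : C(ℝ≥0∞, ℝ)) + ((t : ℝ) * (1 - t)) • resolventMap t) = 0 := by
      have e : ∀ x, ((t : ℝ) • (1 : C(ℝ≥0∞, ℝ)) + ((t : ℝ) * (1 - t)) • resolventMap t) x =
          phi t x := by
        intro x
        rw [phi_eq_resolventENNReal]
        simp [resolventMap_apply]
      change ∫ x, ((t : ℝ) • (1 : C(ℝ≥0∞, ℝ)) + ((t : ℝ) * (1 - t)) • resolventMap t) x ∂m₁ -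
        ∫ x, ((t : ℝ) • (1 : C(ℝ≥0∞, ℝ)) + ((t : ℝ) * (1 - t)) • resolventMap t) x ∂m₂ = 0
      simp only [e]
      rw [← h₁ t (le_of_lt t.2), ← h₂ t (le_of_lt t.2), sub_self]
    rwa [map_add, map_smul, map_smul, smul_eq_mul, smul_eq_mul] at h0
  have hone : I 1 = 0 := by simpa using hphi ⟨1, mem_Ioi.2 one_pos⟩
  have hres : ∀ t, t ≠ ⟨1, mem_Ioi.2 one_pos⟩ → I (resolventMap t) = 0 := by
    intro t ht
    have h := hphi t
    have ht0 : (t : ℝ) ≠ 0 := ne_of_gt t.2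
    have ht1 : 1 - (t : ℝ) ≠ 0 := sub_ne_zero.2 fun h => ht (Subtype.ext h.symm)
    rw [hone, mul_zero, zero_add] at h
    exact (mul_eq_zero.1 h).resolve_left (mul_ne_zero ht0 ht1)
  have hI : I = 0 := eq_zero_of_apply_resolventMap_eq_zero I hone fun t => by
    by_cases ht : t = ⟨1, mem_Ioi.2 one_pos⟩
    · rw [ht]
      -- At t = 1 the coefficient t(1 - t) vanishes, so this resolvent is reached by continuity in
      -- t.
      exact eq_zero_of_eq_zero_of_ne (h := fun s => I (resolventMap s))
        (I.continuous.comp resolventMap.continuous) hres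
    · exact hres t ht
  refine ext_of_forall_integral_eq_of_IsFiniteMeasure fun g => ?_
  exact sub_eq_zero.1 (DFunLike.congr_fun hI g.toContinuousMap)

/-! ### The atoms at 0 and ∞ and the integral formula -/

theorem IsRepresentedBy.measureReal_singleton_zero {f : ℝ → ℝ} {m : Measure ℝ≥0∞}
    (h : IsRepresentedBy f m) : m.real {0} = f 0 := by
  rw [h 0 le_rfl, ← integral_indicator_one (measurableSet_singleton 0)]
  refine integral_congr_ae (ae_of_all _ fun x => ?_)
  simp [phi_zero_left, indicator_apply]

/-- Dominated convergence: as t → ∞, φ_t / t tends pointwise to the indicator of {∞} and is bounded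
by 2 for t ≥ 1. -/
theorem IsRepresentedBy.tendsto_div {f : ℝ → ℝ} {m : Measure ℝ≥0∞} [IsFiniteMeasure m]
    (h : IsRepresentedBy f m) : Tendsto (fun t : ℝ => f t / t) atTop (𝓝 (m.real {∞})) := by
  have lim : Tendsto (fun t => ∫ x, phi t x / t ∂m) atTop
      (𝓝 (∫ x, indicator {∞} (1 : ℝ≥0∞ → ℝ) x ∂m)) := by
    refine tendsto_integral_filter_of_dominated_convergence (fun _ => 2) ?_ ?_
      (integrable_const _) (ae_of_all _ fun x => ?_)
    · filter_upwards [eventually_ge_atTop 0] with t ht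
      exact ((integrable_phi m t ht).div_const t).aestronglyMeasurable
    · filter_upwards [eventually_ge_atTop 1] with t ht
      refine ae_of_all _ fun x => ?_
      have ht0 : 0 < t := by linarith
      rw [Real.norm_eq_abs, abs_div, abs_of_pos ht0, div_le_iff₀ ht0]
      linarith [abs_phi_le ht0.le x]
    · by_cases h0 : x = 0
      · simpa [phi, h0] using tendsto_inv_atTop_zero
      by_cases hi : x = ∞
      · refine tendsto_const_nhds.congr' ?_
        filter_upwards [eventually_gt_atTop 0] with t ht
        simp [phi, hi, ht.ne']
      · rw [indicator_of_notMem (by simpa using hi)]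
        have h1 : Tendsto (fun t : ℝ => (1 + x.toReal) / (t + x.toReal)) atTop (𝓝 0) :=
          tendsto_const_nhds.div_atTop (tendsto_atTop_add_const_right _ _ tendsto_id)
        refine h1.congr' ?_
        filter_upwards [eventually_gt_atTop 0] with t ht
        rw [phi_of_pos_of_lt_top t h0 hi]
        have := x.toReal_nonneg
        have : t + x.toReal ≠ 0 := by linarith
        field_simp
  rw [integral_indicator_one (measurableSet_singleton ∞)] at lim
  refine lim.congr' ?_
  filter_upwards [eventually_ge_atTop 0] with t ht
  rw [integral_div, h t ht]

theorem integrableOn_phi_formula (m : Measure ℝ≥0∞) [IsFiniteMeasure m] {t : ℝ} (ht : 0 ≤ t) :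
    IntegrableOn (fun x : ℝ≥0∞ => t * (1 + x.toReal) / (t + x.toReal)) (Ioo 0 ∞) m :=
  (integrable_phi m t ht).integrableOn.congr_fun
    (fun _ hx => phi_of_pos_of_lt_top t hx.1.ne' hx.2.ne) measurableSet_Ioo

theorem IsRepresentedBy.eq_add_setIntegral {f : ℝ → ℝ} {m : Measure ℝ≥0∞} [IsFiniteMeasure m]
    (h : IsRepresentedBy f m) {t : ℝ} (ht : 0 ≤ t) :
    f t = m.real {0} + m.real {∞} * t +
      ∫ x in Ioo (0 : ℝ≥0∞) ∞, t * (1 + x.toReal) / (t + x.toReal) ∂m := by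
  have hint := integrable_phi m t ht
  have h1 : ({0} ∪ {∞} ∪ Ioo 0 ∞ : Set ℝ≥0∞) = univ := by
    ext x
    simp only [mem_union, mem_singleton_iff, mem_Ioo, mem_univ, iff_true, pos_iff_ne_zero,
      lt_top_iff_ne_top]
    tauto
  rw [h t ht, ← setIntegral_univ, ← h1, setIntegral_union (by
      rw [disjoint_left]
      rintro x (rfl | rfl) ⟨h2, h3⟩
      · exact h2.false
      · exact h3.false) measurableSet_Ioo hint.integrableOn hint.integrableOn,
    setIntegral_union (by simp) (measurableSet_singleton _) hint.integrableOn hint.integrableOn,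
    integral_singleton, integral_singleton,
    setIntegral_congr_fun measurableSet_Ioo
      fun x hx => phi_of_pos_of_lt_top t (ne_of_gt hx.1) (ne_of_lt hx.2)]
  simp [phi]

theorem theorem2p7p6 (f : ℝ → ℝ) (hf : ContinuousOn f (Ici 0)) (hf0 : ∀ t, 0 ≤ t → 0 ≤ f t) :
    (IsOperatorMonotoneOn (Ici 0) f ↔
      ∃ m : Measure ℝ≥0∞, IsFiniteMeasure m ∧ IsRepresentedBy f m) ∧
    (∀ m₁ m₂ : Measure ℝ≥0∞, IsFiniteMeasure m₁ → IsFiniteMeasure m₂ →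
      IsRepresentedBy f m₁ → IsRepresentedBy f m₂ → m₁ = m₂) ∧
    (∀ m : Measure ℝ≥0∞, IsFiniteMeasure m → IsRepresentedBy f m →
      m.real {0} = f 0 ∧
      Tendsto (fun t : ℝ => f t / t) atTop (𝓝 (m.real {∞})) ∧
      ∀ t : ℝ, 0 ≤ t →
        IntegrableOn (fun x : ℝ≥0∞ => t * (1 + x.toReal) / (t + x.toReal)) (Ioo 0 ∞) m ∧
        f t = m.real {0} + m.real {∞} * t +
          ∫ x in Ioo (0 : ℝ≥0∞) ∞, t * (1 + x.toReal) / (t + x.toReal) ∂m) := by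
  refine ⟨⟨fun h => h.exists_isRepresentedBy hf hf0, fun ⟨m, hm, h⟩ => h.isOperatorMonotoneOn⟩,
    fun m₁ m₂ _ _ h₁ h₂ => h₁.unique h₂, fun m _ h => ⟨h.measureReal_singleton_zero,
      h.tendsto_div, fun t ht => ⟨integrableOn_phi_formula m ht, h.eq_add_setIntegral ht⟩⟩⟩
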